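/- Let $T>0$. All processes are defined on a probability space $(\Omega,\mathcal F,\mathbf P)$, are indexed by $[0,T]$ and have almost surely continuous paths. A fractional Brownian motion (fBm) with Hurst index $H\in(0,1)$ is a centered Gaussian process $B=(B_t)_{t\in[0,T]}$ with $B_0=0$ and $\mathbf{Cov}[B_t,B_s]=\tfrac12\left(t^{2H}+s^{2H}-|t-s|^{2H}\right)$; for $H=1/2$ it is the standard Brownian motion (Bm). Let $s_0,\sigma,\nu>0$, $\mu\in\mathbb R$. Let $W$ be a Bm and $B$ an fBm with Hurst index $H\in(0,1)$, $H\neq 1/2$. The price process $S=(S_t)_{t\in[0,T]}$ is - in the BS model: $S_t=s_0e^{\mu t+\sigma W_t-\frac12\sigma^2t}$; - in the fBS model: $S_t=s_0e^{\mu t+\nu B_t}$; - in the mfBS model: $S_t=s_0e^{\mu t+\sigma W_t-\frac12\sigma^2t+\nu B_t}$, where $W$ and $B$ are independent. For $t\in[0,T]$ and $n\in\mathbb N$ put $$V^n_t(S)=\sum_{\substack{0\le i\le 2^n-1\\ Ti/2^n\le t}}\left(S_{T(i+1)/2^n}-S_{Ti/2^n}\right)^2 ,$$ and call $\langle S\rangle_t=\lim_{n\to\infty}V^n_t(S)$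 the pathwise quadratic variation of $S$ along dyadic partitions, if almost surely the limit exists for all $t\in[0,T]$. Then: 1. In the fBS model and in the mfBS model with $H<1/2$, almost surely $V^n_t(S)\to+\infty$ as $n\to\infty$ for all $t\in(0,T]$. 2. In the fBS model with $H>1/2$, the quadratic variation exists and, almost surely, $\langle S\rangle_t=0$ for all $t\in[0,T]$. 3. In the BS model and in the mfBS model with $H>1/2$, the quadratic variation exists and satisfies $d\langle S\rangle_t=\sigma^2S_t^2\,dt$, that is, almost surely, $\langle S\rangle_t=\int_0^t\sigma^2S_u^2\,du$ for all $t\in[0,T]$. -/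

import Mathlib

open MeasureTheory ProbabilityTheory Filter Topology

noncomputable section

namespace FractionalPricing

variable {Ω : Type*} [MeasurableSpace Ω]

/-- Processes on `[0, T]` are written as functions `ℝ → Ω → ℝ`; only their values at times in
`[0, T]` matter.  `IsFBM P T H B`: the process `B` is, on `[0, T]`, a fractional Brownian motion
with Hurst index `H ∈ (0, 1)` under `P`, with almost surely continuous paths. -/
structure IsFBM (P : Measure Ω) (T H : ℝ) (B : ℝ → Ω → ℝ) : Prop where
  hurst_pos : 0 < H
  hurst_lt_one : H < 1
  gaussian : IsGaussianProcess (fun t : Set.Icc (0 : ℝ) T => B t) P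
  centered : ∀ t ∈ Set.Icc (0 : ℝ) T, ∫ ω, B t ω ∂P = 0
  start : ∀ᵐ ω ∂P, B 0 ω = 0
  covariance_eq : ∀ s ∈ Set.Icc (0 : ℝ) T, ∀ t ∈ Set.Icc (0 : ℝ) T,
    covariance (B t) (B s) P = 1 / 2 * (t ^ (2 * H) + s ^ (2 * H) - |t - s| ^ (2 * H))
  continuous_paths : ∀ᵐ ω ∂P, ContinuousOn (fun t => B t ω) (Set.Icc 0 T)

/-- Standard Brownian motion on `[0, T]`: the case `H = 1/2`, where the covariance is
`min s t`. -/
def IsBM (P : Measure Ω) (T : ℝ) (W : ℝ → Ω → ℝ) : Prop :=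
  IsFBM P T (1 / 2) W

/-- The Black–Scholes model. -/
def IsBSModel (P : Measure Ω) (T s₀ μ σ : ℝ) (S : ℝ → Ω → ℝ) : Prop :=
  0 < s₀ ∧ 0 < σ ∧ ∃ W : ℝ → Ω → ℝ, IsBM P T W ∧
    ∀ᵐ ω ∂P, ∀ t ∈ Set.Icc (0 : ℝ) T,
      S t ω = s₀ * Real.exp (μ * t + σ * W t ω - 1 / 2 * σ ^ 2 * t)

/-- The fractional Black–Scholes model with Hurst index `H ≠ 1/2`. -/
def IsFBSModel (P : Measure Ω) (T H s₀ μ ν : ℝ) (S : ℝ → Ω → ℝ) : Prop :=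
  H ≠ 1 / 2 ∧ 0 < s₀ ∧ 0 < ν ∧ ∃ B : ℝ → Ω → ℝ, IsFBM P T H B ∧
    ∀ᵐ ω ∂P, ∀ t ∈ Set.Icc (0 : ℝ) T,
      S t ω = s₀ * Real.exp (μ * t + ν * B t ω)

/-- The mixed fractional Black–Scholes model with Hurst index `H ≠ 1/2`: the Brownian motion `W`
and the fractional Brownian motion `B` are independent as processes on `[0, T]`. -/
def IsMFBSModel (P : Measure Ω) (T H s₀ μ σ ν : ℝ) (S : ℝ → Ω → ℝ) : Prop :=
  H ≠ 1 / 2 ∧ 0 < s₀ ∧ 0 < σ ∧ 0 < ν ∧ ∃ W B : ℝ → Ω → ℝ, IsBM P T W ∧ IsFBM P T H B ∧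
    IndepFun (fun ω (t : Set.Icc (0 : ℝ) T) => W t ω) (fun ω (t : Set.Icc (0 : ℝ) T) => B t ω) P ∧
    ∀ᵐ ω ∂P, ∀ t ∈ Set.Icc (0 : ℝ) T,
      S t ω = s₀ * Real.exp (μ * t + σ * W t ω - 1 / 2 * σ ^ 2 * t + ν * B t ω)

open Classical in
/-- The sum of squared increments of the path `x` over the `n`-th dyadic partition of `[0, T]`,
taken over the partition points `T i / 2 ^ n ≤ t` with `0 ≤ i ≤ 2 ^ n - 1`. -/
def dyadicQVSum (T : ℝ) (x : ℝ → ℝ) (t : ℝ) (n : ℕ) : ℝ :=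
  ∑ i ∈ (Finset.range (2 ^ n)).filter (fun i : ℕ => T * (i : ℝ) / 2 ^ n ≤ t),
    (x (T * ((i : ℝ) + 1) / 2 ^ n) - x (T * (i : ℝ) / 2 ^ n)) ^ 2

/-- `A` is the pathwise quadratic variation of `X` on `[0, T]` along dyadic partitions: almost
surely, for every `t ∈ [0, T]`, the dyadic sums converge to `A t`. -/
def HasDyadicQV (P : Measure Ω) (T : ℝ) (X A : ℝ → Ω → ℝ) : Prop :=
  ∀ᵐ ω ∂P, ∀ t ∈ Set.Icc (0 : ℝ) T,
    Tendsto (fun n => dyadicQVSum T (fun s => X s ω) t n) atTop (𝓝 (A t ω))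

/-- The dyadic sums of squared increments of `X` diverge to `+∞`: almost surely, for every
`t ∈ (0, T]`.  At `t = 0` the sum is the single term `(X_{T / 2 ^ n} - X_0) ^ 2`, which tends to
`0` for a continuous path, so this time is left out. -/
def DyadicQVDiverges (P : Measure Ω) (T : ℝ) (X : ℝ → Ω → ℝ) : Prop :=
  ∀ᵐ ω ∂P, ∀ t ∈ Set.Ioc (0 : ℝ) T,
    Tendsto (fun n => dyadicQVSum T (fun s => X s ω) t n) atTop atTop

end FractionalPricing

end

open FractionalPricing

/-! Write `S = s₀ exp x`. By the mean value and intermediate value theorems, each squared increment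
of `S` is `S_u ^ 2` times that of `x`, with `u` in the same dyadic interval. A positive minimum of
`S` therefore transfers divergence from `x` to `S`. If the sums of `x` tend to `c t` for every `t`,
the squared increments act as weights approximating `c dt`, and the sums of `S` tend to `∫ c S ^ 2`
(`tendsto_weighted_dyadic_sum`). Inside `x`, a summand of zero quadratic variation is removed by
Cauchy–Schwarz, and a divergent one survives because `(p + q) ^ 2 ≥ q ^ 2 / 2 - p ^ 2`.

For fractional Brownian motion with mesh `δ` and `N` intervals, the mean of the sum is `N δ ^ (2H)`,
where `N δ → t`. If `H > 1/2`, these means are summable in `n`, so the sums vanish almost surely. If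
`H ≤ 1/2`, distinct increments have nonpositive correlations whose absolute row sums telescope to at
most `2`. With Isserlis' formula the variance divided by the squared mean is at most `8 / N`, which
is summable along dyadic partitions. The sums are then asymptotic to their means: they tend to `+∞`
for `H < 1/2` and to `t` for `H = 1/2`. Monotonicity in `t` makes the exceptional null set
independent of `t`. -/

/-! ### Almost sure convergence from moments, and Gaussian fourth moments. -/

/-- The series of the `f n` has finite expectation, so it converges almost surely and its terms
vanish. -/
theorem ae_tendsto_zero_of_summable_integral {Ω : Type*} [MeasurableSpace Ω] {P : Measure Ω}
    {f : ℕ → Ω → ℝ} {a : ℕ → ℝ} (hf : ∀ n, Integrable (f n) P) (hf0 : ∀ n ω, 0 ≤ f n ω)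
    (hfa : ∀ n, ∫ ω, f n ω ∂P ≤ a n) (ha : Summable a) :
    ∀ᵐ ω ∂P, Tendsto (fun n => f n ω) atTop (𝓝 0) := by
  have hfin : ∫⁻ ω, ∑' n, ENNReal.ofReal (f n ω) ∂P ≠ ⊤ := by
    rw [lintegral_tsum fun n => (hf n).aemeasurable.ennreal_ofReal]
    refine ne_top_of_le_ne_top ha.tsum_ofReal_ne_top (ENNReal.tsum_le_tsum fun n => ?_)
    rw [← ofReal_integral_eq_lintegral_ofReal (hf n) (ae_of_all _ (hf0 n))]
    exact ENNReal.ofReal_le_ofReal (hfa n)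
  filter_upwards [ae_lt_top' (AEMeasurable.tsum
    fun n => (hf n).aemeasurable.ennreal_ofReal) hfin] with ω hω
  have h := ENNReal.tendsto_atTop_zero_of_tsum_ne_top hω.ne
  have h' := (ENNReal.tendsto_toReal ENNReal.zero_ne_top).comp h
  simpa [Function.comp_def, ENNReal.toReal_ofReal, hf0] using h'

theorem integral_pow_four_gaussianReal (v : NNReal) :
    ∫ x, x ^ 4 ∂(gaussianReal 0 v) = 3 * (v : ℝ) ^ 2 := by
  have h := iteratedDeriv_mgf_zero (X := (id : ℝ → ℝ)) (μ := gaussianReal 0 v) (by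
    simp [integrableExpSet_id_gaussianReal]) 4
  simp only [Pi.pow_apply, id] at h
  rw [← h, mgf_id_gaussianReal]
  generalize (v : ℝ) = w
  have e1 : deriv (fun t : ℝ => Real.exp (0 * t + w * t ^ 2 / 2)) =
      fun t => (w * t) * Real.exp (0 * t + w * t ^ 2 / 2) := by
    funext t
    have : HasDerivAt (fun t : ℝ => Real.exp (0 * t + w * t ^ 2 / 2)) _ t :=
      (((hasDerivAt_id t).const_mul (0 : ℝ)).add
        ((((hasDerivAt_id t).pow 2).const_mul w).div_const 2)).exp
    rw [this.deriv]; simp; ring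
  -- Every derivative of the moment generating function is a polynomial times the same exponential;
  -- `key` tracks the polynomial factor.
  have key : ∀ p p' : ℝ → ℝ, (∀ t, HasDerivAt p (p' t) t) →
      deriv (fun t : ℝ => p t * Real.exp (0 * t + w * t ^ 2 / 2)) =
      fun t => (p' t + p t * (w * t)) * Real.exp (0 * t + w * t ^ 2 / 2) := by
    intro p p' hp
    funext t
    have h1 : HasDerivAt (fun t : ℝ => Real.exp (0 * t + w * t ^ 2 / 2)) _ t :=
      (((hasDerivAt_id t).const_mul (0 : ℝ)).add
        ((((hasDerivAt_id t).pow 2).const_mul w).div_const 2)).exp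
    rw [((hp t).fun_mul h1).deriv]; simp; ring
  have d1 : ∀ t : ℝ, HasDerivAt (fun t => w * t) w t := fun t => by
    simpa using (hasDerivAt_id t).const_mul w
  have d2 : ∀ t : ℝ, HasDerivAt (fun t => w + w * t * (w * t)) (2 * w ^ 2 * t) t := fun t => by
    exact (((d1 t).fun_mul (d1 t)).const_add w).congr_deriv (by ring)
  have d3 : ∀ t : ℝ, HasDerivAt (fun t => 2 * w ^ 2 * t + (w + w * t * (w * t)) * (w * t))
      (2 * w ^ 2 + (2 * w ^ 2 * t * (w * t) + (w + w * t * (w * t)) * w)) t := fun t => by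
    exact (((hasDerivAt_id t).const_mul (2 * w ^ 2)).fun_add
      ((d2 t).fun_mul (d1 t))).congr_deriv (by ring)
  rw [iteratedDeriv_eq_iterate]
  simp only [Function.iterate_succ, Function.iterate_zero, Function.comp_apply, id]
  rw [e1, key _ _ d1, key _ _ d2, key _ _ d3]
  simp; ring

theorem ProbabilityTheory.HasGaussianLaw.integral_pow_four {Ω : Type*} [MeasurableSpace Ω]
    {P : Measure Ω}
    {X : Ω → ℝ} (hX : HasGaussianLaw X P) (h0 : ∫ ω, X ω ∂P = 0) :
    ∫ ω, X ω ^ 4 ∂P = 3 * (∫ ω, X ω ^ 2 ∂P) ^ 2 := by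
  have hm := hX.map_eq_gaussianReal
  rw [h0, variance_of_integral_eq_zero hX.aemeasurable h0] at hm
  have h := integral_map (μ := P) hX.aemeasurable
    (f := fun x : ℝ => x ^ 4) (by fun_prop)
  rw [← h, hm, integral_pow_four_gaussianReal,
    Real.coe_toNNReal _ (integral_nonneg fun ω => sq_nonneg _)]

/-- Isserlis' formula by polarization: `12 X²Y² = (X+Y)⁴ + (X-Y)⁴ - 2(X⁴ + Y⁴)`, and each fourth
power on the right is that of a centered Gaussian variable. -/
theorem integral_sq_mul_sq_of_hasGaussianLaw {Ω : Type*} [MeasurableSpace Ω] {P : Measure Ω}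
    {X Y : Ω → ℝ} (hXY : HasGaussianLaw (fun ω => (X ω, Y ω)) P)
    (hX0 : ∫ ω, X ω ∂P = 0) (hY0 : ∫ ω, Y ω ∂P = 0) :
    Integrable (fun ω => X ω ^ 2 * Y ω ^ 2) P ∧
    ∫ ω, X ω ^ 2 * Y ω ^ 2 ∂P =
      (∫ ω, X ω ^ 2 ∂P) * (∫ ω, Y ω ^ 2 ∂P) + 2 * (∫ ω, X ω * Y ω ∂P) ^ 2 := by
  have hX := hXY.fst
  have hY := hXY.snd
  have hp : ∀ {Z : Ω → ℝ}, HasGaussianLaw Z P → Integrable (fun ω => Z ω ^ 4) P := fun hZ => by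
    have := (hZ.memLp (p := 4) (by norm_num)).integrable_norm_pow (by norm_num)
    refine this.congr (ae_of_all _ fun ω => ?_)
    simp only [Real.norm_eq_abs]
    exact Even.pow_abs (by decide) _
  have iX := hX.integrable
  have iY := hY.integrable
  have iX2 := hX.memLp_two.integrable_sq
  have iY2 := hY.memLp_two.integrable_sq
  have iXY : Integrable (fun ω => X ω * Y ω) P := hX.memLp_two.integrable_mul hY.memLp_two
  have ha := hXY.fun_add
  have hs := hXY.fun_sub
  have ea := ha.integral_pow_four (by rw [integral_add iX iY, hX0, hY0, add_zero])
  have es := hs.integral_pow_four (by rw [integral_sub iX iY, hX0, hY0, sub_zero])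
  have eX := hX.integral_pow_four hX0
  have eY := hY.integral_pow_four hY0
  have iS : Integrable (fun ω => X ω ^ 2 + Y ω ^ 2) P := iX2.add iY2
  have e2a : ∫ ω, (X ω + Y ω) ^ 2 ∂P =
      ∫ ω, X ω ^ 2 ∂P + ∫ ω, Y ω ^ 2 ∂P + 2 * ∫ ω, X ω * Y ω ∂P := by
    rw [← integral_add iX2 iY2, ← integral_const_mul, ← integral_add iS
      (iXY.const_mul 2)]
    congr 1; funext ω; ring
  have e2s : ∫ ω, (X ω - Y ω) ^ 2 ∂P =
      ∫ ω, X ω ^ 2 ∂P + ∫ ω, Y ω ^ 2 ∂P - 2 * ∫ ω, X ω * Y ω ∂P := by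
    rw [← integral_add iX2 iY2, ← integral_const_mul, ← integral_sub iS
      (iXY.const_mul 2)]
    congr 1; funext ω; ring
  have hid : (fun ω => X ω ^ 2 * Y ω ^ 2) = fun ω =>
      (1 / 12 : ℝ) * (((X ω + Y ω) ^ 4 + (X ω - Y ω) ^ 4) - 2 * (X ω ^ 4 + Y ω ^ 4)) := by
    funext ω; ring
  have i1 := (hp ha).add (hp hs)
  have i2 := ((hp hX).add (hp hY)).const_mul 2
  refine ⟨by rw [hid]; exact (i1.sub i2).const_mul _, ?_⟩
  have := integral_sub i1 i2
  simp only [Pi.add_apply] at this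
  rw [hid, integral_const_mul, this, integral_add (hp ha) (hp hs), integral_const_mul,
    integral_add (hp hX) (hp hY), ea, es, eX, eY, e2a, e2s]
  ring

/-- Expand the square: by Isserlis' formula the covariance of `X i ^ 2` and `X j ^ 2` is twice the
squared covariance of `X i` and `X j`. Only pairwise joint Gaussianity enters. -/
theorem integral_sq_sum_sq_sub {Ω ι : Type*} [MeasurableSpace Ω] {P : Measure Ω}
    {X : ι → Ω → ℝ} (s : Finset ι)
    (hX : ∀ i ∈ s, ∀ j ∈ s, HasGaussianLaw (fun ω => (X i ω, X j ω)) P)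
    (hX0 : ∀ i ∈ s, ∫ ω, X i ω ∂P = 0) {v : ℝ} (hv : ∀ i ∈ s, ∫ ω, X i ω ^ 2 ∂P = v) :
    Integrable (fun ω => (∑ i ∈ s, X i ω ^ 2 - s.card * v) ^ 2) P ∧
    ∫ ω, (∑ i ∈ s, X i ω ^ 2 - s.card * v) ^ 2 ∂P =
      ∑ i ∈ s, ∑ j ∈ s, 2 * (∫ ω, X i ω * X j ω ∂P) ^ 2 := by
  have hid : (fun ω => (∑ i ∈ s, X i ω ^ 2 - s.card * v) ^ 2) = fun ω =>
      ∑ i ∈ s, ∑ j ∈ s, (X i ω ^ 2 * X j ω ^ 2 - v * X i ω ^ 2 - v * X j ω ^ 2 + v ^ 2) := by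
    funext ω
    have : ∑ i ∈ s, X i ω ^ 2 - s.card * v = ∑ i ∈ s, (X i ω ^ 2 - v) := by
      simp [Finset.sum_sub_distrib]
    rw [this, sq, Finset.sum_mul_sum]
    refine Finset.sum_congr rfl fun i _ => Finset.sum_congr rfl fun j _ => by ring
  have hterm : ∀ i ∈ s, ∀ j ∈ s,
      Integrable (fun ω => X i ω ^ 2 * X j ω ^ 2 - v * X i ω ^ 2 - v * X j ω ^ 2 + v ^ 2) P ∧
      ∫ ω, (X i ω ^ 2 * X j ω ^ 2 - v * X i ω ^ 2 - v * X j ω ^ 2 + v ^ 2) ∂P =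
        2 * (∫ ω, X i ω * X j ω ∂P) ^ 2 := by
    intro i hi j hj
    have hij := hX i hi j hj
    have := hij.isProbabilityMeasure
    obtain ⟨h1, h2⟩ := integral_sq_mul_sq_of_hasGaussianLaw hij (hX0 i hi) (hX0 j hj)
    have iX2 := hij.fst.memLp_two.integrable_sq.const_mul v
    have iY2 := hij.snd.memLp_two.integrable_sq.const_mul v
    have i1 : Integrable (fun ω => X i ω ^ 2 * X j ω ^ 2 - v * X i ω ^ 2) P := h1.sub iX2
    have i2 : Integrable (fun ω => X i ω ^ 2 * X j ω ^ 2 - v * X i ω ^ 2 - v * X j ω ^ 2) P :=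
      i1.sub iY2
    refine ⟨i2.add (integrable_const _), ?_⟩
    rw [integral_add i2 (integrable_const _), integral_sub i1 iY2, integral_sub h1 iX2, h2, integral_const_mul,
      integral_const_mul, hv i hi, hv j hj]
    simp; ring
  rw [hid]
  refine ⟨integrable_finsetSum _ fun i hi => integrable_finsetSum _ fun j hj =>
    (hterm i hi j hj).1, ?_⟩
  rw [integral_finsetSum _ fun i hi => integrable_finsetSum _ fun j hj => (hterm i hi j hj).1]
  refine Finset.sum_congr rfl fun i hi => ?_
  rw [integral_finsetSum _ fun j hj => (hterm i hi j hj).1]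
  exact Finset.sum_congr rfl fun j hj => (hterm i hi j hj).2

/-! ### Correlations of fractional Gaussian noise. -/

/-- The correlation at lag `k` of the unit increments of a fractional Brownian motion with Hurst
index `α / 2`. -/
noncomputable def incrementCorr (α k : ℝ) : ℝ :=
  (|k + 1| ^ α + |k - 1| ^ α - 2 * |k| ^ α) / 2

theorem incrementCorr_zero {α : ℝ} (hα : 0 < α) : incrementCorr α 0 = 1 := by
  simp [incrementCorr, Real.zero_rpow hα.ne']

theorem incrementCorr_neg (α k : ℝ) : incrementCorr α (-k) = incrementCorr α k := by
  unfold incrementCorr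
  rw [← abs_neg (-k + 1), ← abs_neg (-k - 1), abs_neg k]
  ring_nf

/-- This is half a second difference of the concave function `t ↦ t ^ α` on `[0, ∞)`; `|k| ≥ 1`
keeps all three points in that half-line. -/
theorem incrementCorr_nonpos {α k : ℝ} (hα : 0 < α) (hα1 : α ≤ 1) (hk : 1 ≤ |k|) :
    incrementCorr α k ≤ 0 := by
  wlog h : 0 ≤ k generalizing k
  · rw [← incrementCorr_neg]
    exact this (by rwa [abs_neg]) (by linarith)
  rw [abs_of_nonneg h] at hk
  unfold incrementCorr
  rw [abs_of_nonneg h, abs_of_nonneg (by linarith : 0 ≤ k + 1),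
    abs_of_nonneg (by linarith : 0 ≤ k - 1)]
  have h1 : k + 1 ∈ Set.Ici (0 : ℝ) := Set.mem_Ici.2 (by linarith)
  have h2 : k - 1 ∈ Set.Ici (0 : ℝ) := Set.mem_Ici.2 (by linarith)
  have half : (0 : ℝ) ≤ 1 / 2 := by norm_num
  have hc := (Real.concaveOn_rpow hα.le hα1).2 h1 h2 half half (by norm_num)
  simp only [smul_eq_mul] at hc
  rw [show (1 / 2 * (k + 1) + 1 / 2 * (k - 1) : ℝ) = k by ring] at hc
  linarith

/-- Only the diagonal term is positive, so the absolute sum is `2` minus the signed sum. The signed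
sum telescopes to a nonnegative quantity. -/
theorem sum_abs_incrementCorr_le {α : ℝ} (hα : 0 < α) (hα1 : α ≤ 1) {i N : ℕ} (hi : i < N) :
    ∑ j ∈ Finset.range N, |incrementCorr α ((i : ℝ) - j)| ≤ 2 := by
  have habs : ∀ j ∈ Finset.range N, |incrementCorr α ((i : ℝ) - j)| =
      (if j = i then 2 else 0) - incrementCorr α ((i : ℝ) - j) := by
    intro j _
    split_ifs with h
    · subst h; rw [sub_self, incrementCorr_zero hα]; norm_num
    · rw [abs_of_nonpos (incrementCorr_nonpos hα hα1 ?_)]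
      · ring
      · have : (i : ℤ) - j ≠ 0 := fun h' => h (by omega)
        exact_mod_cast Int.one_le_abs this
  rw [Finset.sum_congr rfl habs, Finset.sum_sub_distrib, Finset.sum_ite_eq',
    if_pos (Finset.mem_range.2 hi)]
  have htel : ∑ j ∈ Finset.range N, incrementCorr α ((i : ℝ) - j) =
      ((|(i : ℝ) - (0 : ℕ) + 1| ^ α - |(i : ℝ) - (0 : ℕ)| ^ α) -
        (|(i : ℝ) - N + 1| ^ α - |(i : ℝ) - N| ^ α)) / 2 := by
    rw [← Finset.sum_range_sub' (fun j : ℕ => |(i : ℝ) - j + 1| ^ α - |(i : ℝ) - j| ^ α),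
      Finset.sum_div]
    refine Finset.sum_congr rfl fun j _ => ?_
    unfold incrementCorr
    push_cast
    rw [show (i : ℝ) - (j + 1) + 1 = i - j by ring, show (i : ℝ) - (j + 1) = i - j - 1 by ring]
    ring
  have hiN : (i : ℝ) + 1 ≤ N := by exact_mod_cast hi
  have h1 : |(i : ℝ) - (0 : ℕ)| ^ α ≤ |(i : ℝ) - (0 : ℕ) + 1| ^ α := by
    refine Real.rpow_le_rpow (abs_nonneg _) ?_ hα.le
    simp only [Nat.cast_zero, sub_zero]
    rw [abs_of_nonneg (by positivity), abs_of_nonneg (by positivity)]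
    linarith
  have h2 : |(i : ℝ) - N + 1| ^ α ≤ |(i : ℝ) - N| ^ α := by
    refine Real.rpow_le_rpow (abs_nonneg _) ?_ hα.le
    rw [abs_of_nonpos (by linarith), abs_of_nonpos (by linarith)]
    linarith
  rw [htel]
  exact sub_le_self _ (div_nonneg (sub_nonneg.2 ((sub_nonpos.2 h2).trans (sub_nonneg.2 h1)))
    zero_le_two)

theorem sum_sq_incrementCorr_le {α : ℝ} (hα : 0 < α) (hα1 : α ≤ 1) {i N : ℕ} (hi : i < N) :
    ∑ j ∈ Finset.range N, incrementCorr α ((i : ℝ) - j) ^ 2 ≤ 4 := by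
  have h := sum_abs_incrementCorr_le hα hα1 hi
  calc ∑ j ∈ Finset.range N, incrementCorr α ((i : ℝ) - j) ^ 2
      = ∑ j ∈ Finset.range N, |incrementCorr α ((i : ℝ) - j)| ^ 2 := by simp only [sq_abs]
    _ ≤ (∑ j ∈ Finset.range N, |incrementCorr α ((i : ℝ) - j)|) ^ 2 :=
        Finset.sum_sq_le_sq_sum_of_nonneg fun _ _ => abs_nonneg _
    _ ≤ 2 ^ 2 := pow_le_pow_left₀ (Finset.sum_nonneg fun _ _ => abs_nonneg _) h 2
    _ = 4 := by norm_num

/-! ### Gaussian increments and their covariances. -/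

section Increments

variable {Ω : Type*} [MeasurableSpace Ω] {P : Measure Ω} {T H : ℝ} {B : ℝ → Ω → ℝ}

theorem FractionalPricing.IsFBM.hasGaussianLaw_increments_prodMk (hB : IsFBM P T H B)
    {a b c d : ℝ} (ha : a ∈ Set.Icc 0 T) (hb : b ∈ Set.Icc 0 T) (hc : c ∈ Set.Icc 0 T)
    (hd : d ∈ Set.Icc 0 T) :
    HasGaussianLaw (fun ω => (B b ω - B a ω, B d ω - B c ω)) P := by
  have hinc : IsGaussianProcess
      (fun (p : Set.Icc (0 : ℝ) T × Set.Icc (0 : ℝ) T) ω => B p.2 ω - B p.1 ω) P := by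
    classical
    exact hB.gaussian.of_isGaussianProcess fun p => ⟨{p.1, p.2},
      { toFun x := x ⟨p.2, by simp⟩ - x ⟨p.1, by simp⟩
        map_add' x y := by simp; abel
        map_smul' c x := by simp; ring }, by simp⟩
  exact hinc.hasGaussianLaw_prodMk (s := (⟨a, ha⟩, ⟨b, hb⟩)) (t := (⟨c, hc⟩, ⟨d, hd⟩))

theorem FractionalPricing.IsFBM.integral_increment (hB : IsFBM P T H B)
    {a b : ℝ} (ha : a ∈ Set.Icc 0 T) (hb : b ∈ Set.Icc 0 T) :
    ∫ ω, (B b ω - B a ω) ∂P = 0 := by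
  rw [integral_sub (hB.gaussian.hasGaussianLaw_eval ⟨b, hb⟩).integrable
    (hB.gaussian.hasGaussianLaw_eval ⟨a, ha⟩).integrable, hB.centered _ ha, hB.centered _ hb,
    sub_zero]

theorem FractionalPricing.IsFBM.integral_increment_mul_increment (hB : IsFBM P T H B)
    {a b c d : ℝ} (ha : a ∈ Set.Icc 0 T) (hb : b ∈ Set.Icc 0 T) (hc : c ∈ Set.Icc 0 T)
    (hd : d ∈ Set.Icc 0 T) :
    ∫ ω, (B b ω - B a ω) * (B d ω - B c ω) ∂P =
      1 / 2 * (|b - c| ^ (2 * H) + |a - d| ^ (2 * H) - |b - d| ^ (2 * H) - |a - c| ^ (2 * H)) := by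
  have := hB.gaussian.isProbabilityMeasure
  have hL : ∀ {t : ℝ}, t ∈ Set.Icc 0 T → MemLp (B t) 2 P := fun ht =>
    (hB.gaussian.hasGaussianLaw_eval ⟨_, ht⟩).memLp_two
  have hcov : ∀ {s t : ℝ}, s ∈ Set.Icc 0 T → t ∈ Set.Icc 0 T →
      cov[B s, B t; P] = 1 / 2 * (s ^ (2 * H) + t ^ (2 * H) - |s - t| ^ (2 * H)) :=
    fun hs ht => hB.covariance_eq _ ht _ hs
  have h := covariance_fun_sub_fun_sub (hL hb) (hL ha) (hL hd) (hL hc)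
  rw [hcov hb hd, hcov hb hc, hcov ha hd, hcov ha hc, covariance,
    hB.integral_increment ha hb, hB.integral_increment hc hd] at h
  simp only [sub_zero] at h
  rw [h]
  ring

theorem dyadic_mem_Icc (hT : 0 ≤ T) {i n : ℕ} (hi : i ≤ 2 ^ n) :
    T * (i : ℝ) / 2 ^ n ∈ Set.Icc 0 T := by
  have h : (i : ℝ) ≤ 2 ^ n := by exact_mod_cast hi
  refine ⟨by positivity, ?_⟩
  rw [div_le_iff₀ (by positivity)]
  gcongr

theorem dyadic_succ_mem_Icc (hT : 0 ≤ T) {i n : ℕ} (hi : i < 2 ^ n) :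
    T * ((i : ℝ) + 1) / 2 ^ n ∈ Set.Icc 0 T := by
  exact_mod_cast dyadic_mem_Icc hT (Nat.succ_le_of_lt hi)

theorem FractionalPricing.IsFBM.integral_dyadic_increments (hB : IsFBM P T H B) (hT : 0 ≤ T)
    {i j n : ℕ} (hi : i < 2 ^ n) (hj : j < 2 ^ n) :
    ∫ ω, (B (T * ((i : ℝ) + 1) / 2 ^ n) ω - B (T * (i : ℝ) / 2 ^ n) ω) *
      (B (T * ((j : ℝ) + 1) / 2 ^ n) ω - B (T * (j : ℝ) / 2 ^ n) ω) ∂P =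
      (T / 2 ^ n) ^ (2 * H) * incrementCorr (2 * H) ((i : ℝ) - j) := by
  rw [hB.integral_increment_mul_increment (dyadic_mem_Icc hT hi.le) (dyadic_succ_mem_Icc hT hi)
    (dyadic_mem_Icc hT hj.le) (dyadic_succ_mem_Icc hT hj)]
  have hδ : (0 : ℝ) ≤ T / 2 ^ n := by positivity
  have key : ∀ x y : ℝ, |T * x / 2 ^ n - T * y / 2 ^ n| ^ (2 * H) =
      (T / 2 ^ n) ^ (2 * H) * |x - y| ^ (2 * H) := fun x y => by
    rw [show T * x / 2 ^ n - T * y / 2 ^ n = T / 2 ^ n * (x - y) by ring, abs_mul,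
      abs_of_nonneg hδ, Real.mul_rpow hδ (abs_nonneg _)]
  rw [key, key, key, key, incrementCorr, show (i : ℝ) + 1 - j = i - j + 1 by ring,
    show (i : ℝ) - (j + 1) = i - j - 1 by ring, show (i : ℝ) + 1 - (j + 1) = i - j by ring]
  -- The four powers carry the common factor `(T / 2 ^ n) ^ (2 * H)`: self-similarity and
  -- stationarity of the increments.
  ring

end Increments

/-! ### Counting dyadic intervals. -/

/-- The number of intervals of the `n`-th dyadic partition of `[0, T]` that start at or before
`t`. -/
noncomputable def dyadicCount (T t : ℝ) (n : ℕ) : ℕ := min (2 ^ n) (⌊t * 2 ^ n / T⌋₊ + 1)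

theorem dyadicCount_le (T t : ℝ) (n : ℕ) : dyadicCount T t n ≤ 2 ^ n := min_le_left _ _

theorem dyadicCount_mono {T s t : ℝ} (hT : 0 < T) (hst : s ≤ t) (n : ℕ) :
    dyadicCount T s n ≤ dyadicCount T t n := by
  unfold dyadicCount
  gcongr

theorem lt_dyadicCount_iff {T t : ℝ} (hT : 0 < T) (ht : 0 ≤ t) {i n : ℕ} :
    i < dyadicCount T t n ↔ i < 2 ^ n ∧ T * (i : ℝ) / 2 ^ n ≤ t := by
  -- The `+ 1` accounts for the index `0`; the cap `2 ^ n` takes effect only for `t ≥ T`.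
  rw [dyadicCount, lt_min_iff, Nat.lt_succ_iff, Nat.le_floor_iff (by positivity),
    le_div_iff₀ hT, div_le_iff₀ (by positivity), mul_comm T]

theorem dyadicQVSum_eq_sum_range {T t : ℝ} (hT : 0 < T) (ht : 0 ≤ t) (x : ℝ → ℝ) (n : ℕ) :
    dyadicQVSum T x t n = ∑ i ∈ Finset.range (dyadicCount T t n),
      (x (T * ((i : ℝ) + 1) / 2 ^ n) - x (T * (i : ℝ) / 2 ^ n)) ^ 2 := by
  unfold dyadicQVSum
  congr 1
  ext i
  rw [Finset.mem_filter, Finset.mem_range, Finset.mem_range, lt_dyadicCount_iff hT ht]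

theorem le_dyadicCount_mul {T t : ℝ} (hT : 0 < T) (htT : t ≤ T) (n : ℕ) :
    t ≤ dyadicCount T t n * (T / 2 ^ n) := by
  rw [dyadicCount, Nat.cast_min, min_mul_of_nonneg _ _ (by positivity), le_min_iff]
  refine ⟨?_, ?_⟩
  · push_cast
    rw [mul_div_cancel₀ _ (by positivity)]
    exact htT
  · have := (Nat.lt_floor_add_one (t * 2 ^ n / T)).le
    push_cast
    calc t = t * 2 ^ n / T * (T / 2 ^ n) := by field_simp
      _ ≤ _ := by gcongr

theorem dyadicCount_mul_le {T t : ℝ} (hT : 0 < T) (ht : 0 ≤ t) (n : ℕ) :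
    dyadicCount T t n * (T / 2 ^ n) ≤ t + T / 2 ^ n := by
  have h1 : (dyadicCount T t n : ℝ) ≤ t * 2 ^ n / T + 1 := by
    refine le_trans (Nat.cast_le.2 (min_le_right _ _)) ?_
    push_cast
    gcongr
    exact Nat.floor_le (by positivity)
  calc (dyadicCount T t n : ℝ) * (T / 2 ^ n) ≤ (t * 2 ^ n / T + 1) * (T / 2 ^ n) := by gcongr
    _ = t + T / 2 ^ n := by field_simp

theorem tendsto_dyadic_mesh (T : ℝ) : Tendsto (fun n : ℕ => T / 2 ^ n) atTop (𝓝 0) :=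
  tendsto_const_nhds.div_atTop (tendsto_pow_atTop_atTop_of_one_lt one_lt_two)

theorem tendsto_dyadicCount_mul {T t : ℝ} (hT : 0 < T) (ht : t ∈ Set.Icc 0 T) :
    Tendsto (fun n => dyadicCount T t n * (T / 2 ^ n)) atTop (𝓝 t) := by
  refine tendsto_of_tendsto_of_tendsto_of_le_of_le tendsto_const_nhds
    ?_ (le_dyadicCount_mul hT ht.2) (dyadicCount_mul_le hT ht.1)
  simpa using (tendsto_dyadic_mesh T).const_add t

/-! ### Quadratic variation of fractional Brownian motion. -/

section QuadraticVariationFBM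

variable {Ω : Type*} [MeasurableSpace Ω] {P : Measure Ω} {T H : ℝ} {B : ℝ → Ω → ℝ}

theorem FractionalPricing.IsFBM.integral_sq_dyadic_increment (hB : IsFBM P T H B) (hT : 0 ≤ T)
    {i n : ℕ} (hi : i < 2 ^ n) :
    ∫ ω, (B (T * ((i : ℝ) + 1) / 2 ^ n) ω - B (T * (i : ℝ) / 2 ^ n) ω) ^ 2 ∂P =
      (T / 2 ^ n) ^ (2 * H) := by
  have h := hB.integral_dyadic_increments hT hi hi
  rw [sub_self, incrementCorr_zero (by linarith [hB.hurst_pos]), mul_one] at h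
  simpa only [sq] using h

theorem dyadicQVSum_nonneg (T : ℝ) (x : ℝ → ℝ) (t : ℝ) (n : ℕ) : 0 ≤ dyadicQVSum T x t n :=
  Finset.sum_nonneg fun _ _ => sq_nonneg _

theorem dyadicQVSum_mono (T : ℝ) (x : ℝ → ℝ) (n : ℕ) : Monotone (dyadicQVSum T x · n) := by
  intro s t hst
  refine Finset.sum_le_sum_of_subset_of_nonneg (fun i hi => ?_) fun _ _ _ => sq_nonneg _
  rw [Finset.mem_filter] at hi ⊢
  exact ⟨hi.1, hi.2.trans hst⟩

theorem FractionalPricing.IsFBM.integrable_dyadicQVSum (hB : IsFBM P T H B) (hT : 0 < T)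
    {t : ℝ} (ht : 0 ≤ t) (n : ℕ) : Integrable (fun ω => dyadicQVSum T (B · ω) t n) P := by
  simp only [dyadicQVSum_eq_sum_range hT ht]
  refine integrable_finsetSum _ fun i hi => ?_
  have hi' := ((lt_dyadicCount_iff hT ht).1 (Finset.mem_range.1 hi)).1
  have ha := dyadic_mem_Icc hT.le hi'.le
  have hb := dyadic_succ_mem_Icc hT.le hi'
  exact (hB.hasGaussianLaw_increments_prodMk ha hb ha hb).fst.memLp_two.integrable_sq

theorem FractionalPricing.IsFBM.integral_dyadicQVSum (hB : IsFBM P T H B) (hT : 0 < T)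
    {t : ℝ} (ht : 0 ≤ t) (n : ℕ) : ∫ ω, dyadicQVSum T (B · ω) t n ∂P =
      dyadicCount T t n * (T / 2 ^ n) ^ (2 * H) := by
  simp only [dyadicQVSum_eq_sum_range hT ht]
  have hlt : ∀ i ∈ Finset.range (dyadicCount T t n), i < 2 ^ n := fun i hi =>
    ((lt_dyadicCount_iff hT ht).1 (Finset.mem_range.1 hi)).1
  rw [integral_finsetSum]
  · rw [Finset.sum_congr rfl fun i hi => hB.integral_sq_dyadic_increment hT.le (hlt i hi)]
    simp
  · intro i hi
    have ha := dyadic_mem_Icc hT.le (hlt i hi).le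
    have hb := dyadic_succ_mem_Icc hT.le (hlt i hi)
    exact (hB.hasGaussianLaw_increments_prodMk ha hb ha hb).fst.memLp_two.integrable_sq

/-- The constant `8` is the `2` of Isserlis' formula times the row bound `4` on squared
correlations. -/
theorem FractionalPricing.IsFBM.integral_sq_dyadicQVSum_sub_le (hB : IsFBM P T H B)
    (hH : H ≤ 1 / 2) (hT : 0 < T) {t : ℝ} (ht : 0 ≤ t) (n : ℕ) :
    Integrable (fun ω => (dyadicQVSum T (B · ω) t n -
      dyadicCount T t n * (T / 2 ^ n) ^ (2 * H)) ^ 2) P ∧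
    ∫ ω, (dyadicQVSum T (B · ω) t n - dyadicCount T t n * (T / 2 ^ n) ^ (2 * H)) ^ 2 ∂P ≤
      8 * dyadicCount T t n * ((T / 2 ^ n) ^ (2 * H)) ^ 2 := by
  simp only [dyadicQVSum_eq_sum_range hT ht]
  set N := dyadicCount T t n
  have hlt : ∀ i ∈ Finset.range N, i < 2 ^ n := fun i hi =>
    ((lt_dyadicCount_iff hT ht).1 (Finset.mem_range.1 hi)).1
  have ha : ∀ i ∈ Finset.range N, T * (i : ℝ) / 2 ^ n ∈ Set.Icc 0 T := fun i hi =>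
    dyadic_mem_Icc hT.le (hlt i hi).le
  have hb : ∀ i ∈ Finset.range N, T * ((i : ℝ) + 1) / 2 ^ n ∈ Set.Icc 0 T := fun i hi =>
    dyadic_succ_mem_Icc hT.le (hlt i hi)
  obtain ⟨h1, h2⟩ := integral_sq_sum_sq_sub (P := P)
    (X := fun (i : ℕ) ω => B (T * ((i : ℝ) + 1) / 2 ^ n) ω - B (T * (i : ℝ) / 2 ^ n) ω)
    (Finset.range N)
    (fun i hi j hj => hB.hasGaussianLaw_increments_prodMk (ha i hi) (hb i hi) (ha j hj) (hb j hj))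
    (fun i hi => hB.integral_increment (ha i hi) (hb i hi))
    (fun i hi => hB.integral_sq_dyadic_increment hT.le (hlt i hi))
  rw [Finset.card_range] at h1 h2
  refine ⟨h1, h2.trans_le ?_⟩
  calc ∑ i ∈ Finset.range N, ∑ j ∈ Finset.range N, 2 * (∫ ω,
        (B (T * ((i : ℝ) + 1) / 2 ^ n) ω - B (T * (i : ℝ) / 2 ^ n) ω) *
          (B (T * ((j : ℝ) + 1) / 2 ^ n) ω - B (T * (j : ℝ) / 2 ^ n) ω) ∂P) ^ 2
      = ∑ i ∈ Finset.range N, 2 * ((T / 2 ^ n) ^ (2 * H)) ^ 2 *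
          ∑ j ∈ Finset.range N, incrementCorr (2 * H) ((i : ℝ) - j) ^ 2 := by
        refine Finset.sum_congr rfl fun i hi => ?_
        rw [Finset.mul_sum]
        refine Finset.sum_congr rfl fun j hj => ?_
        rw [hB.integral_dyadic_increments hT.le (hlt i hi) (hlt j hj)]
        ring
    _ ≤ ∑ i ∈ Finset.range N, 2 * ((T / 2 ^ n) ^ (2 * H)) ^ 2 * 4 := by
        gcongr with i hi
        exact sum_sq_incrementCorr_le (by linarith [hB.hurst_pos]) (by linarith)
          (Finset.mem_range.1 hi)
    _ = 8 * N * ((T / 2 ^ n) ^ (2 * H)) ^ 2 := by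
        simp; ring

/-- For `H ≤ 1 / 2` the dyadic sums of squared increments of a fractional Brownian motion are
almost surely asymptotic to their expectations. -/
theorem FractionalPricing.IsFBM.ae_tendsto_dyadicQVSum_div (hB : IsFBM P T H B)
    (hH : H ≤ 1 / 2) (hT : 0 < T) {t : ℝ} (ht : t ∈ Set.Ioc 0 T) :
    ∀ᵐ ω ∂P, Tendsto (fun n => dyadicQVSum T (B · ω) t n /
      (dyadicCount T t n * (T / 2 ^ n) ^ (2 * H))) atTop (𝓝 1) := by
  set m : ℕ → ℝ := fun n => dyadicCount T t n * (T / 2 ^ n) ^ (2 * H)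
  have hN : ∀ n, t / T * 2 ^ n ≤ dyadicCount T t n := fun n => by
    have := le_dyadicCount_mul hT ht.2 n
    rw [← mul_div_assoc, le_div_iff₀ (by positivity)] at this
    rw [div_mul_eq_mul_div, div_le_iff₀ hT]
    exact this
  have ht0 : 0 < t / T := div_pos ht.1 hT
  have hN0 : ∀ n, (0 : ℝ) < dyadicCount T t n := fun n => lt_of_lt_of_le (by positivity) (hN n)
  have hm : ∀ n, 0 < m n := fun n => mul_pos (hN0 n) (by positivity)
  -- The relative variance is at most `8 / N`, and `N ≥ (t / T) 2 ^ n` makes this geometric.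
  have h := ae_tendsto_zero_of_summable_integral (P := P)
    (f := fun n ω => (dyadicQVSum T (B · ω) t n - m n) ^ 2 / m n ^ 2)
    (a := fun n => 8 / (t / T) * (1 / 2) ^ n)
    (fun n => (hB.integral_sq_dyadicQVSum_sub_le hH hT ht.1.le n).1.div_const _)
    (fun n ω => by positivity)
    (fun n => ?_) (summable_geometric_two.mul_left _)
  · filter_upwards [h] with ω hω
    have h1 : Tendsto (fun n => dyadicQVSum T (B · ω) t n / m n - 1) atTop (𝓝 0) := by
      rw [tendsto_zero_iff_abs_tendsto_zero]
      have := hω.sqrt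
      rw [Real.sqrt_zero] at this
      refine this.congr fun n => ?_
      rw [← div_pow, Real.sqrt_sq_eq_abs, sub_div, div_self (hm n).ne']
      rfl
    simpa using h1.add_const 1
  · rw [integral_div, div_le_iff₀ (pow_pos (hm n) 2)]
    refine (hB.integral_sq_dyadicQVSum_sub_le hH hT ht.1.le n).2.trans ?_
    have e : 8 / (t / T) * (1 / 2) ^ n * m n ^ 2 =
        8 * dyadicCount T t n * ((T / 2 ^ n) ^ (2 * H)) ^ 2 *
          (dyadicCount T t n / (t / T * 2 ^ n)) := by
      simp only [m, one_div, inv_pow]; field_simp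
    rw [e]
    refine le_mul_of_one_le_right (by positivity) ?_
    rw [one_le_div (by positivity)]
    exact hN n

theorem FractionalPricing.IsFBM.ae_tendsto_dyadicQVSum_atTop (hB : IsFBM P T H B)
    (hH : H < 1 / 2) (hT : 0 < T) :
    ∀ᵐ ω ∂P, ∀ t ∈ Set.Ioc 0 T, Tendsto (dyadicQVSum T (B · ω) t) atTop atTop := by
  have hfix : ∀ t ∈ Set.Ioc 0 T, ∀ᵐ ω ∂P,
      Tendsto (dyadicQVSum T (B · ω) t) atTop atTop := by
    intro t ht
    filter_upwards [hB.ae_tendsto_dyadicQVSum_div hH.le hT ht] with ω hω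
    have hcount := tendsto_dyadicCount_mul hT (Set.Ioc_subset_Icc_self ht)
    have hmesh : Tendsto (fun n : ℕ => (T / 2 ^ n) ^ (2 * H - 1)) atTop atTop := by
      refine (tendsto_rpow_neg_nhdsGT_zero (by linarith)).comp
        (tendsto_nhdsWithin_iff.2 ⟨tendsto_dyadic_mesh T, Eventually.of_forall fun n => ?_⟩)
      exact Set.mem_Ioi.2 (by positivity)
    refine ((hmesh.atTop_mul_pos ht.1 hcount).atTop_mul_pos one_pos hω).congr fun n => ?_
    have hN : (0 : ℝ) < dyadicCount T t n := by
      have := ht.1.trans_le (le_dyadicCount_mul hT ht.2 n)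
      exact pos_of_mul_pos_left this (by positivity)
    have hδ : 0 < T / 2 ^ n := by positivity
    have e : (T / 2 ^ n) ^ (2 * H) = (T / 2 ^ n) ^ (2 * H - 1) * (T / 2 ^ n) := by
      rw [Real.rpow_sub_one hδ.ne', div_mul_cancel₀ _ hδ.ne']
    rw [e]
    have : 0 < (T / 2 ^ n) ^ (2 * H - 1) := by positivity
    field_simp
  -- The sums increase with `t`, so divergence at countably many times decreasing to `0` gives
  -- divergence at every positive time.
  have hall : ∀ᵐ ω ∂P, ∀ k : ℕ, Tendsto (dyadicQVSum T (B · ω) (T / (k + 1))) atTop atTop := by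
    refine ae_all_iff.2 fun k => hfix _ ⟨by positivity, ?_⟩
    exact div_le_self hT.le (by linarith [(Nat.cast_nonneg k : (0 : ℝ) ≤ k)])
  filter_upwards [hall] with ω hω t ht
  obtain ⟨k, hk⟩ := exists_nat_one_div_lt (div_pos ht.1 hT)
  refine tendsto_atTop_mono (fun n => dyadicQVSum_mono T _ n ?_) (hω k)
  rw [lt_div_iff₀ hT] at hk
  have : T / (k + 1) = 1 / (k + 1) * T := by ring
  linarith

/-- Squeeze between nearby times of a countable dense set. Rational multiples of `T` are used so
that the endpoint `T` belongs to the set. -/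
theorem tendsto_of_monotone_of_tendsto_dense {T : ℝ} {f : ℕ → ℝ → ℝ} (hT : 0 < T)
    (hf : ∀ n, Monotone (f n)) (h0 : Tendsto (f · 0) atTop (𝓝 0))
    (hq : ∀ q : ℚ, (q : ℝ) ∈ Set.Ioc (0 : ℝ) 1 → Tendsto (f · (T * q)) atTop (𝓝 (T * q)))
    {t : ℝ} (ht : t ∈ Set.Icc 0 T) : Tendsto (f · t) atTop (𝓝 t) := by
  rw [tendsto_order]
  constructor
  · intro a ha
    obtain hneg | hpos := lt_or_ge a 0
    · filter_upwards [h0.eventually (lt_mem_nhds hneg)] with n hn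
      exact hn.trans_le (hf n ht.1)
    · obtain ⟨q, hq1, hq2⟩ := exists_rat_btwn (div_lt_div_of_pos_right ha hT)
      rw [div_lt_iff₀ hT, mul_comm] at hq1
      rw [lt_div_iff₀ hT, mul_comm] at hq2
      have hq0 : (0 : ℝ) < q := pos_of_mul_pos_right (hpos.trans_lt hq1) hT.le
      have hq1' : (q : ℝ) ≤ 1 := by
        by_contra! hcon
        nlinarith [ht.2]
      filter_upwards [(hq q ⟨hq0, hq1'⟩).eventually (lt_mem_nhds hq1)] with n hn
      exact hn.trans_le (hf n hq2.le)
  · intro b hb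
    -- At `t = T` no time to the right is available; convergence at `T` itself (`q = 1`) replaces
    -- it.
    obtain hTt | htT := ht.2.eq_or_lt
    · have := hq 1 ⟨by norm_num, by norm_num⟩
      simp only [Rat.cast_one, mul_one] at this
      rw [← hTt] at this
      exact this.eventually (gt_mem_nhds hb)
    · obtain ⟨q, hq1, hq2⟩ := exists_rat_btwn (div_lt_div_of_pos_right (lt_min hb htT) hT)
      rw [div_lt_iff₀ hT, mul_comm] at hq1
      rw [lt_div_iff₀ hT, mul_comm, lt_min_iff] at hq2
      have hq0 : (0 : ℝ) < q := pos_of_mul_pos_right (ht.1.trans_lt hq1) hT.le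
      have hq1' : (q : ℝ) ≤ 1 := by
        by_contra! hcon
        nlinarith [hq2.2]
      filter_upwards [(hq q ⟨hq0, hq1'⟩).eventually (gt_mem_nhds hq2.1)] with n hn
      exact (hf n hq1.le).trans_lt hn

theorem tendsto_dyadicQVSum_zero_time {x : ℝ → ℝ} (hT : 0 < T)
    (hx : ContinuousOn x (Set.Icc 0 T)) :
    Tendsto (dyadicQVSum T x 0) atTop (𝓝 0) := by
  have hc : ∀ n, dyadicCount T 0 n = 1 := fun n => by
    simp [dyadicCount, Nat.one_le_two_pow]
  have h0 : Tendsto (fun n : ℕ => x (T / 2 ^ n)) atTop (𝓝 (x 0)) := by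
    refine (hx 0 ⟨le_rfl, hT.le⟩).tendsto.comp
      (tendsto_nhdsWithin_iff.2 ⟨tendsto_dyadic_mesh T, Eventually.of_forall fun n => ?_⟩)
    exact ⟨by positivity, div_le_self hT.le (one_le_pow₀ (by norm_num))⟩
  have h1 := (h0.sub_const (x 0)).pow 2
  rw [sub_self, zero_pow two_ne_zero] at h1
  refine h1.congr fun n => ?_
  rw [dyadicQVSum_eq_sum_range hT le_rfl, hc]
  simp

theorem FractionalPricing.IsBM.ae_tendsto_dyadicQVSum {W : ℝ → Ω → ℝ} (hW : IsBM P T W)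
    (hT : 0 < T) :
    ∀ᵐ ω ∂P, ∀ t ∈ Set.Icc 0 T, Tendsto (dyadicQVSum T (W · ω) t) atTop (𝓝 t) := by
  have hfix : ∀ t ∈ Set.Ioc 0 T, ∀ᵐ ω ∂P, Tendsto (dyadicQVSum T (W · ω) t) atTop (𝓝 t) := by
    intro t ht
    filter_upwards [IsFBM.ae_tendsto_dyadicQVSum_div hW le_rfl hT ht] with ω hω
    have h := hω.mul (tendsto_dyadicCount_mul hT (Set.Ioc_subset_Icc_self ht))
    rw [one_mul] at h
    refine h.congr fun n => ?_
    have : 0 < dyadicCount T t n * (T / 2 ^ n) := ht.1.trans_le (le_dyadicCount_mul hT ht.2 n)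
    rw [show (2 : ℝ) * (1 / 2) = 1 by norm_num, Real.rpow_one, div_mul_cancel₀ _ this.ne']
  have hall : ∀ᵐ ω ∂P, ∀ q : ℚ, (q : ℝ) ∈ Set.Ioc (0 : ℝ) 1 →
      Tendsto (dyadicQVSum T (W · ω) (T * q)) atTop (𝓝 (T * q)) := by
    refine ae_all_iff.2 fun q => ?_
    by_cases hq : (q : ℝ) ∈ Set.Ioc (0 : ℝ) 1
    · filter_upwards [hfix (T * q) ⟨mul_pos hT hq.1, mul_le_of_le_one_right hT.le hq.2⟩]
        with ω hω _ using hω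
    · exact ae_of_all _ fun ω h => absurd h hq
  filter_upwards [hall, IsFBM.continuous_paths hW] with ω hω hc t ht
  exact tendsto_of_monotone_of_tendsto_dense (f := fun n t => dyadicQVSum T (W · ω) t n) hT
    (dyadicQVSum_mono T _) (tendsto_dyadicQVSum_zero_time hT hc) hω ht

/-- A first moment is enough: at time `T` it is at most `T ^ (2H) * 2 ^ (n (1 - 2H))`, summable for
`H > 1/2`. Monotonicity in `t` covers earlier times. -/
theorem FractionalPricing.IsFBM.ae_tendsto_dyadicQVSum_zero (hB : IsFBM P T H B)
    (hH : 1 / 2 < H) (hT : 0 < T) :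
    ∀ᵐ ω ∂P, ∀ t ∈ Set.Icc 0 T, Tendsto (dyadicQVSum T (B · ω) t) atTop (𝓝 0) := by
  have hr : (2 : ℝ) ^ (1 - 2 * H) < 1 := Real.rpow_lt_one_of_one_lt_of_neg (by norm_num)
    (by linarith)
  have h := ae_tendsto_zero_of_summable_integral (P := P)
    (f := fun n ω => dyadicQVSum T (B · ω) T n)
    (a := fun n => T ^ (2 * H) * ((2 : ℝ) ^ (1 - 2 * H)) ^ n)
    (hB.integrable_dyadicQVSum hT hT.le) (fun n ω => dyadicQVSum_nonneg _ _ _ _) (fun n => ?_)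
    ((summable_geometric_of_lt_one (by positivity) hr).mul_left _)
  · filter_upwards [h] with ω hω t ht
    exact squeeze_zero (dyadicQVSum_nonneg T _ t) (fun n => dyadicQVSum_mono T _ n ht.2) hω
  · rw [hB.integral_dyadicQVSum hT hT.le, Real.div_rpow hT.le (by positivity), Real.rpow_sub
      two_pos, Real.rpow_one, div_pow]
    have hN : (dyadicCount T T n : ℝ) ≤ 2 ^ n := by exact_mod_cast dyadicCount_le T T n
    have e : ((2 : ℝ) ^ n) ^ (2 * H) = ((2 : ℝ) ^ (2 * H)) ^ n := by
      rw [← Real.rpow_natCast, ← Real.rpow_natCast, ← Real.rpow_mul two_pos.le,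
        ← Real.rpow_mul two_pos.le, mul_comm]
    rw [e, ← mul_div_assoc, ← mul_div_assoc, mul_comm]
    gcongr

end QuadraticVariationFBM

/-! ### Pathwise calculus: sums, exponentials and Riemann sums. -/

section Paths

variable {T : ℝ}

theorem dyadicQVSum_const_mul (T c : ℝ) (x : ℝ → ℝ) (t : ℝ) (n : ℕ) :
    dyadicQVSum T (fun s => c * x s) t n = c ^ 2 * dyadicQVSum T x t n := by
  unfold dyadicQVSum
  rw [Finset.mul_sum]
  exact Finset.sum_congr rfl fun i _ => by ring

theorem tendsto_dyadicQVSum_linear (hT : 0 < T) (a : ℝ) {t : ℝ} (ht : t ∈ Set.Icc 0 T) :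
    Tendsto (dyadicQVSum T (fun s => a * s) t) atTop (𝓝 0) := by
  have h := ((tendsto_dyadicCount_mul hT ht).mul (tendsto_dyadic_mesh T)).const_mul (a ^ 2)
  rw [mul_zero, mul_zero] at h
  refine h.congr fun n => ?_
  have hterm : ∀ i : ℕ, (a * (T * ((i : ℝ) + 1) / 2 ^ n) - a * (T * (i : ℝ) / 2 ^ n)) ^ 2 =
      a ^ 2 * (T / 2 ^ n) ^ 2 := fun i => by ring
  simp only [dyadicQVSum_eq_sum_range hT ht.1, hterm, Finset.sum_const, Finset.card_range,
    nsmul_eq_mul]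
  ring

/-- By Cauchy–Schwarz the squared cross term is at most the product of the two sums, which tends to
`a * 0`. -/
theorem tendsto_dyadicQVSum_add {x z : ℝ → ℝ} {t a : ℝ}
    (hx : Tendsto (dyadicQVSum T x t) atTop (𝓝 a)) (hz : Tendsto (dyadicQVSum T z t) atTop (𝓝 0)) :
    Tendsto (dyadicQVSum T (fun s => x s + z s) t) atTop (𝓝 a) := by
  classical
  set c : ℕ → ℝ := fun n =>
    ∑ i ∈ (Finset.range (2 ^ n)).filter (fun i : ℕ => T * (i : ℝ) / 2 ^ n ≤ t),
      (x (T * ((i : ℝ) + 1) / 2 ^ n) - x (T * (i : ℝ) / 2 ^ n)) *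
        (z (T * ((i : ℝ) + 1) / 2 ^ n) - z (T * (i : ℝ) / 2 ^ n)) with hc
  have hsum : ∀ n, dyadicQVSum T (fun s => x s + z s) t n =
      dyadicQVSum T x t n + 2 * c n + dyadicQVSum T z t n := by
    intro n
    simp only [dyadicQVSum, hc]
    rw [Finset.mul_sum, ← Finset.sum_add_distrib, ← Finset.sum_add_distrib]
    refine Finset.sum_congr (by congr) fun i _ => by ring
  have hcs : ∀ n, c n ^ 2 ≤ dyadicQVSum T x t n * dyadicQVSum T z t n := by
    intro n
    refine (Finset.sum_mul_sq_le_sq_mul_sq _ _ _).trans (le_of_eq ?_)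
    simp only [dyadicQVSum]
  have hc0 : Tendsto c atTop (𝓝 0) := by
    have h1 : Tendsto (fun n => c n ^ 2) atTop (𝓝 0) :=
      squeeze_zero (fun n => sq_nonneg _) hcs (by simpa using hx.mul hz)
    rw [tendsto_zero_iff_abs_tendsto_zero]
    have h2 := h1.sqrt
    rw [Real.sqrt_zero] at h2
    exact h2.congr fun n => Real.sqrt_sq_eq_abs _
  have h := (hx.add (hc0.const_mul 2)).add hz
  rw [mul_zero, add_zero, add_zero] at h
  exact h.congr fun n => (hsum n).symm

theorem tendsto_dyadicQVSum_add_atTop {x z : ℝ → ℝ} {t a : ℝ}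
    (hx : Tendsto (dyadicQVSum T x t) atTop (𝓝 a))
    (hz : Tendsto (dyadicQVSum T z t) atTop atTop) :
    Tendsto (dyadicQVSum T (fun s => x s + z s) t) atTop atTop := by
  refine tendsto_atTop_mono (fun n => ?_)
    ((hz.const_mul_atTop (by norm_num : (0 : ℝ) < 1 / 2)).atTop_add hx.neg)
  simp only [dyadicQVSum]
  rw [Finset.mul_sum, ← Finset.sum_neg_distrib, ← Finset.sum_add_distrib]
  refine Finset.sum_le_sum fun i _ => ?_
  set p := x (T * ((i : ℝ) + 1) / 2 ^ n)
  set q := x (T * (i : ℝ) / 2 ^ n)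
  set p' := z (T * ((i : ℝ) + 1) / 2 ^ n)
  set q' := z (T * (i : ℝ) / 2 ^ n)
  -- With `d = p - q` and `d' = p' - q'`: `(d + d')² - d'² / 2 + d² = (2d + d')² / 2`.
  nlinarith [sq_nonneg (2 * (p - q) + (p' - q'))]

/-- The mean value theorem gives an intermediate value of `x`; continuity of the path turns it into
a value attained at a time `u`. -/
theorem exists_exp_sub_exp_eq {x : ℝ → ℝ} {a b : ℝ} (hab : a ≤ b)
    (hx : ContinuousOn x (Set.Icc a b)) :
    ∃ u ∈ Set.Icc a b, Real.exp (x b) - Real.exp (x a) = Real.exp (x u) * (x b - x a) := by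
  have hmvt : ∀ {p q : ℝ}, p < q → ∃ r ∈ Set.Icc p q,
      Real.exp q - Real.exp p = Real.exp r * (q - p) := fun {p q} hpq => by
    obtain ⟨r, hr, h⟩ := exists_deriv_eq_slope Real.exp hpq Real.continuous_exp.continuousOn
      Real.differentiable_exp.differentiableOn
    refine ⟨r, Set.Ioo_subset_Icc_self hr, ?_⟩
    rw [Real.deriv_exp] at h
    rw [h, div_mul_cancel₀ _ (sub_pos.2 hpq).ne']
  rcases lt_trichotomy (x a) (x b) with h | h | h
  · obtain ⟨r, hr, e⟩ := hmvt h
    obtain ⟨u, hu, rfl⟩ := intermediate_value_Icc hab hx hr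
    exact ⟨u, hu, e⟩
  · exact ⟨a, ⟨le_rfl, hab⟩, by simp [h]⟩
  · obtain ⟨r, hr, e⟩ := hmvt h
    obtain ⟨u, hu, rfl⟩ := intermediate_value_Icc' hab hx hr
    exact ⟨u, hu, by linarith⟩

/-- On each dyadic interval the squared increment of `S = s₀ exp x` is that of `x` times the square
of an intermediate value of `S`. -/
theorem exists_sq_dyadic_increment_exp_eq {x S : ℝ → ℝ} {s₀ : ℝ} (hT : 0 < T)
    (hx : ContinuousOn x (Set.Icc 0 T)) (hS : ∀ s ∈ Set.Icc 0 T, S s = s₀ * Real.exp (x s))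
    {n i : ℕ} (hi : i < 2 ^ n) :
    ∃ u ∈ Set.Icc (T * (i : ℝ) / 2 ^ n) (T * ((i : ℝ) + 1) / 2 ^ n),
      (S (T * ((i : ℝ) + 1) / 2 ^ n) - S (T * (i : ℝ) / 2 ^ n)) ^ 2 =
        S u ^ 2 * (x (T * ((i : ℝ) + 1) / 2 ^ n) - x (T * (i : ℝ) / 2 ^ n)) ^ 2 := by
  have ha := dyadic_mem_Icc hT.le hi.le
  have hb := dyadic_succ_mem_Icc hT.le hi
  have hsub := Set.Icc_subset_Icc ha.1 hb.2
  have hab : T * (i : ℝ) / 2 ^ n ≤ T * ((i : ℝ) + 1) / 2 ^ n := by gcongr; linarith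
  obtain ⟨u, hu, e⟩ := exists_exp_sub_exp_eq hab (hx.mono hsub)
  refine ⟨u, hu, ?_⟩
  rw [hS _ ha, hS _ hb, hS _ (hsub hu), ← mul_sub, e]
  ring

/-- On the compact interval `S` is bounded below by its minimum `s₀ exp (x r) > 0`. -/
theorem tendsto_dyadicQVSum_exp_atTop {x S : ℝ → ℝ} {s₀ : ℝ} (hT : 0 < T) (hs₀ : 0 < s₀)
    (hx : ContinuousOn x (Set.Icc 0 T)) (hS : ∀ s ∈ Set.Icc 0 T, S s = s₀ * Real.exp (x s))
    {t : ℝ} (ht : 0 ≤ t) (hV : Tendsto (dyadicQVSum T x t) atTop atTop) :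
    Tendsto (dyadicQVSum T S t) atTop atTop := by
  obtain ⟨r, -, hr⟩ := isCompact_Icc.exists_isMinOn ⟨0, le_rfl, hT.le⟩ hx
  have hm : 0 < s₀ * Real.exp (x r) := by positivity
  refine tendsto_atTop_mono (fun n => ?_) (hV.const_mul_atTop (pow_pos hm 2))
  rw [dyadicQVSum_eq_sum_range hT ht, dyadicQVSum_eq_sum_range hT ht, Finset.mul_sum]
  refine Finset.sum_le_sum fun i hi => ?_
  have hi' := ((lt_dyadicCount_iff hT ht).1 (Finset.mem_range.1 hi)).1
  obtain ⟨u, hu, e⟩ := exists_sq_dyadic_increment_exp_eq hT hx hS hi'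
  have hu' := Set.Icc_subset_Icc (dyadic_mem_Icc hT.le hi'.le).1 (dyadic_succ_mem_Icc hT.le hi').2 hu
  rw [e, hS u hu']
  have : x r ≤ x u := hr hu'
  gcongr

/-- If nonnegative weights attached to the dyadic intervals have total mass on `[0, t]`
converging to `c t` for every `t`, then the weighted Riemann sums of a continuous function
converge to `c` times its integral. -/
theorem tendsto_weighted_dyadic_sum {φ : ℝ → ℝ} {d u : ℕ → ℕ → ℝ} {c : ℝ} (hT : 0 < T) (hc : 0 ≤ c)
    (hφ : ContinuousOn φ (Set.Icc 0 T)) (hd : ∀ n i, 0 ≤ d n i)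
    (hu : ∀ n i : ℕ, i < 2 ^ n → u n i ∈ Set.Icc (T * (i : ℝ) / 2 ^ n) (T * ((i : ℝ) + 1) / 2 ^ n))
    (hF : ∀ t ∈ Set.Icc 0 T,
      Tendsto (fun n => ∑ i ∈ Finset.range (dyadicCount T t n), d n i) atTop (𝓝 (c * t)))
    {t : ℝ} (ht : t ∈ Set.Icc 0 T) :
    Tendsto (fun n => ∑ i ∈ Finset.range (dyadicCount T t n), φ (u n i) * d n i) atTop
      (𝓝 (c * ∫ s in (0 : ℝ)..t, φ s)) := by
  set F : ℕ → ℝ → ℝ := fun n t => ∑ i ∈ Finset.range (dyadicCount T t n), d n i with hFdef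
  set G : ℕ → ℝ → ℝ := fun n t => ∑ i ∈ Finset.range (dyadicCount T t n), φ (u n i) * d n i
    with hGdef
  set E : ℕ → ℝ → ℝ := fun n t => G n t - c * ∫ s in (0 : ℝ)..t, φ s with hEdef
  have huT : ∀ {n i}, i < 2 ^ n → u n i ∈ Set.Icc 0 T := fun {n i} hi =>
    Set.Icc_subset_Icc (dyadic_mem_Icc hT.le hi.le).1 (dyadic_succ_mem_Icc hT.le hi).2 (hu n i hi)
  have hint : ∀ {a b}, a ∈ Set.Icc 0 T → b ∈ Set.Icc 0 T →
      IntervalIntegrable φ volume a b := fun ha hb =>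
    (hφ.mono (Set.uIcc_subset_Icc ha hb)).intervalIntegrable
  -- Over a short interval `φ` is frozen at `s`. Its oscillation costs `ε c (s' - s)` in the limit
  -- against the weights and as much against the integral; the `+ 1` is slack for passing to the
  -- limit.
  have hstep : ∀ ε > 0, ∃ η > 0, ∀ s ∈ Set.Icc 0 T, ∀ s' ∈ Set.Icc 0 T, s < s' → s' - s < η →
      ∀ᶠ n in atTop, |E n s' - E n s| ≤ ε * (2 * c + 1) * (s' - s) := by
    intro ε hε
    obtain ⟨η, hη, hφη⟩ := Metric.uniformContinuousOn_iff_le.1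
      (isCompact_Icc.uniformContinuousOn_of_continuous hφ) ε hε
    -- The other half of `η` is for the mesh, since a tag may overshoot `s'` by one interval.
    refine ⟨η / 2, by positivity, fun s hs s' hs' hss hη' => ?_⟩
    have hΔ : Tendsto (fun n => F n s' - F n s) atTop (𝓝 (c * s' - c * s)) :=
      (hF s' hs').sub (hF s hs)
    have hR : Tendsto (fun n => ε * (F n s' - F n s) +
        |φ s| * |(F n s' - F n s) - c * (s' - s)| + ε * (c * (s' - s))) atTop
        (𝓝 (ε * (c * s' - c * s) + |φ s| * |(c * s' - c * s) - c * (s' - s)| +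
          ε * (c * (s' - s)))) :=
      ((hΔ.const_mul ε).add ((hΔ.sub_const _).abs.const_mul _)).add_const _
    have hlim : ε * (c * s' - c * s) + |φ s| * |(c * s' - c * s) - c * (s' - s)| +
          ε * (c * (s' - s)) < ε * (2 * c + 1) * (s' - s) := by
      rw [show (c * s' - c * s) - c * (s' - s) = 0 by ring, abs_zero, mul_zero, add_zero]
      have : 0 < ε * (s' - s) := mul_pos hε (sub_pos.2 hss)
      linarith
    filter_upwards [hR.eventually (gt_mem_nhds hlim),
      (tendsto_dyadic_mesh T).eventually (gt_mem_nhds (half_pos hη))] with n hn hmesh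
    refine le_trans ?_ hn.le
    have hN := dyadicCount_mono hT hss.le n
    have hFd : F n s' - F n s = ∑ i ∈ Finset.Ico (dyadicCount T s n) (dyadicCount T s' n), d n i :=
      (Finset.sum_Ico_eq_sub _ hN).symm
    have hGd : G n s' - G n s =
        ∑ i ∈ Finset.Ico (dyadicCount T s n) (dyadicCount T s' n), φ (u n i) * d n i :=
      (Finset.sum_Ico_eq_sub _ hN).symm
    have h1 : |(G n s' - G n s) - φ s * (F n s' - F n s)| ≤ ε * (F n s' - F n s) := by
      rw [hFd, hGd, Finset.mul_sum, Finset.mul_sum, ← Finset.sum_sub_distrib]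
      refine (Finset.abs_sum_le_sum_abs _ _).trans (Finset.sum_le_sum fun i hi => ?_)
      rw [Finset.mem_Ico] at hi
      obtain ⟨hi2, his'⟩ := (lt_dyadicCount_iff hT hs'.1).1 hi.2
      have his : s < T * (i : ℝ) / 2 ^ n := by
        by_contra! hcon
        exact absurd ((lt_dyadicCount_iff hT hs.1).2 ⟨hi2, hcon⟩) (not_lt.2 hi.1)
      have hui := hu n i hi2
      have hsucc : T * ((i : ℝ) + 1) / 2 ^ n = T * (i : ℝ) / 2 ^ n + T / 2 ^ n := by ring
      have hdist : dist (u n i) s ≤ η := by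
        rw [Real.dist_eq, abs_of_nonneg (by linarith [hui.1])]
        linarith [hui.2]
      have := hφη _ (huT hi2) _ hs hdist
      rw [Real.dist_eq] at this
      rw [← sub_mul, abs_mul, abs_of_nonneg (hd n i)]
      exact mul_le_mul_of_nonneg_right this (hd n i)
    have h0 : (0 : ℝ) ∈ Set.Icc 0 T := ⟨le_rfl, hT.le⟩
    have h2 : |(∫ r in s..s', φ r) - φ s * (s' - s)| ≤ ε * (s' - s) := by
      have e : (∫ r in s..s', φ r) - φ s * (s' - s) = ∫ r in s..s', (φ r - φ s) := by
        rw [intervalIntegral.integral_sub (hint hs hs') (by simp),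
          intervalIntegral.integral_const, smul_eq_mul, mul_comm]
      rw [e, ← Real.norm_eq_abs, ← abs_of_pos (sub_pos.2 hss)]
      refine intervalIntegral.norm_integral_le_of_norm_le_const fun r hr => ?_
      rw [Set.uIoc_of_le hss.le] at hr
      rw [← dist_eq_norm]
      refine hφη _ ⟨hs.1.trans hr.1.le, hr.2.trans hs'.2⟩ _ hs ?_
      rw [Real.dist_eq, abs_of_pos (sub_pos.2 hr.1)]
      linarith [hr.2]
    have h3 : (∫ r in (0 : ℝ)..s', φ r) - ∫ r in (0 : ℝ)..s, φ r = ∫ r in s..s', φ r :=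
      intervalIntegral.integral_interval_sub_left (hint h0 hs') (hint h0 hs)
    have hid : E n s' - E n s = ((G n s' - G n s) - φ s * (F n s' - F n s)) +
        φ s * ((F n s' - F n s) - c * (s' - s)) -
        c * ((∫ r in s..s', φ r) - φ s * (s' - s)) := by
      rw [← h3]; simp only [hEdef]; ring
    rw [hid]
    refine (abs_sub _ _).trans (add_le_add ((abs_add_le _ _).trans (add_le_add h1 ?_)) ?_)
    · rw [abs_mul]
    · rw [abs_mul, abs_of_nonneg hc]
      calc c * _ ≤ c * (ε * (s' - s)) := mul_le_mul_of_nonneg_left h2 hc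
        _ = ε * (c * (s' - s)) := by ring
  have hE0 : Tendsto (fun n => E n 0) atTop (𝓝 0) := by
    obtain ⟨M, hM⟩ := isCompact_Icc.exists_bound_of_continuousOn hφ
    have h0 := (hF 0 ⟨le_rfl, hT.le⟩).const_mul M
    rw [mul_zero, mul_zero] at h0
    refine squeeze_zero_norm (fun n => ?_) h0
    simp only [hEdef, hGdef, intervalIntegral.integral_same, mul_zero, sub_zero]
    rw [Finset.mul_sum]
    refine (norm_sum_le _ _).trans (Finset.sum_le_sum fun i hi => ?_)
    rw [norm_mul, Real.norm_of_nonneg (hd n i)]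
    refine mul_le_mul_of_nonneg_right (hM _ (huT ?_)) (hd n i)
    exact ((lt_dyadicCount_iff hT le_rfl).1 (Finset.mem_range.1 hi)).1
  have hbound : ∀ ε > 0, ∀ᶠ n in atTop, |E n t| ≤ ε * (1 + (2 * c + 1) * t) := by
    intro ε hε
    obtain ⟨η, hη, hη'⟩ := hstep ε hε
    obtain rfl | htpos := ht.1.eq_or_lt
    · filter_upwards [(tendsto_zero_iff_abs_tendsto_zero _).1 hE0 |>.eventually (gt_mem_nhds hε)]
        with n hn
      simpa using hn.le
    obtain ⟨m, hm⟩ := exists_nat_gt (t / η)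
    have hm0 : (0 : ℝ) < m := (by positivity : 0 ≤ t / η).trans_lt hm
    -- The local bounds are chained over `m > t / η` equal steps from `0` to `t`; finitely many
    -- eventual statements are combined.
    have hk : ∀ k : ℕ, k ≤ m → ∀ᶠ n in atTop,
        |E n (t * k / m)| ≤ ε * (1 + (2 * c + 1) * (t * k / m)) := by
      intro k
      induction k with
      | zero =>
        intro _
        filter_upwards [(tendsto_zero_iff_abs_tendsto_zero _).1 hE0 |>.eventually
          (gt_mem_nhds hε)] with n hn
        simpa using hn.le
      | succ k ih =>
        intro hkm
        have hmem : ∀ {j : ℕ}, j ≤ m → t * (j : ℝ) / m ∈ Set.Icc 0 T := fun {j} hj => by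
          refine ⟨by positivity, le_trans ?_ ht.2⟩
          rw [div_le_iff₀ hm0]
          gcongr
        have hdiff : t * ((k + 1 : ℕ) : ℝ) / m - t * (k : ℝ) / m = t / m := by
          push_cast; ring
        have hlt : 0 < t / m := by positivity
        filter_upwards [ih (by omega), hη' _ (hmem (by omega : k ≤ m)) _ (hmem hkm)
          (by linarith) (by rw [hdiff, div_lt_iff₀ hm0]; rwa [div_lt_iff₀ hη, mul_comm] at hm)]
          with n h1 h2
        have h3 := abs_add_le (E n (t * ((k + 1 : ℕ) : ℝ) / m) - E n (t * (k : ℝ) / m))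
          (E n (t * (k : ℝ) / m))
        rw [sub_add_cancel] at h3
        linarith
    have := hk m le_rfl
    rwa [mul_div_assoc, div_self hm0.ne', mul_one] at this
  have hEt : Tendsto (fun n => E n t) atTop (𝓝 0) := by
    rw [Metric.tendsto_nhds]
    intro ε hε
    have hK : 0 < 1 + (2 * c + 1) * t := by have := ht.1; positivity
    filter_upwards [hbound (ε / 2 / (1 + (2 * c + 1) * t)) (by positivity)] with n hn
    rw [div_mul_cancel₀ _ hK.ne'] at hn
    rw [dist_zero_right, Real.norm_eq_abs]
    linarith
  simpa [hEdef] using hEt.add_const (c * ∫ s in (0 : ℝ)..t, φ s)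

/-- The squared increments of `x` serve as weights and `S ^ 2` is sampled at the intermediate
points. The case `c = 0` is allowed and gives zero quadratic variation. -/
theorem tendsto_dyadicQVSum_exp {x S : ℝ → ℝ} {s₀ c : ℝ} (hT : 0 < T) (hc : 0 ≤ c)
    (hx : ContinuousOn x (Set.Icc 0 T)) (hS : ∀ s ∈ Set.Icc 0 T, S s = s₀ * Real.exp (x s))
    (hV : ∀ t ∈ Set.Icc 0 T, Tendsto (dyadicQVSum T x t) atTop (𝓝 (c * t)))
    {t : ℝ} (ht : t ∈ Set.Icc 0 T) :
    Tendsto (dyadicQVSum T S t) atTop (𝓝 (∫ s in (0 : ℝ)..t, c * S s ^ 2)) := by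
  have hSc : ContinuousOn (fun s => S s ^ 2) (Set.Icc 0 T) :=
    (((Real.continuous_exp.comp_continuousOn hx).const_mul s₀).congr hS).pow 2
  have hex : ∀ n i : ℕ, ∃ u, i < 2 ^ n →
      u ∈ Set.Icc (T * (i : ℝ) / 2 ^ n) (T * ((i : ℝ) + 1) / 2 ^ n) ∧
      (S (T * ((i : ℝ) + 1) / 2 ^ n) - S (T * (i : ℝ) / 2 ^ n)) ^ 2 =
        S u ^ 2 * (x (T * ((i : ℝ) + 1) / 2 ^ n) - x (T * (i : ℝ) / 2 ^ n)) ^ 2 := by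
    intro n i
    by_cases hi : i < 2 ^ n
    · obtain ⟨u, h⟩ := exists_sq_dyadic_increment_exp_eq hT hx hS hi
      exact ⟨u, fun _ => h⟩
    -- A default tag for indices outside the partition; it never enters the sums.
    · exact ⟨0, fun h => absurd h hi⟩
  choose u hu using hex
  rw [intervalIntegral.integral_const_mul]
  refine (tendsto_weighted_dyadic_sum (φ := fun s => S s ^ 2) (u := u)
    (d := fun n i => (x (T * ((i : ℝ) + 1) / 2 ^ n) - x (T * (i : ℝ) / 2 ^ n)) ^ 2)
    hT hc hSc (fun n i => sq_nonneg _) (fun n i hi => (hu n i hi).1)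
    (fun s hs => ?_) ht).congr
    fun n => ?_
  · exact (hV s hs).congr fun n => dyadicQVSum_eq_sum_range hT hs.1 x n
  · rw [dyadicQVSum_eq_sum_range hT ht.1]
    refine Finset.sum_congr rfl fun i hi => ?_
    exact (hu n i ((lt_dyadicCount_iff hT ht.1).1 (Finset.mem_range.1 hi)).1).2.symm

end Paths

/-! ### The three pricing models. -/

theorem mainTheorem8 {Ω : Type*} [MeasurableSpace Ω] (P : Measure Ω) [IsProbabilityMeasure P]
    (T : ℝ) (hT : 0 < T) (H s₀ μ σ ν : ℝ) (S : ℝ → Ω → ℝ) :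
    (H < 1 / 2 → IsFBSModel P T H s₀ μ ν S → DyadicQVDiverges P T S) ∧
    (H < 1 / 2 → IsMFBSModel P T H s₀ μ σ ν S → DyadicQVDiverges P T S) ∧
    (1 / 2 < H → IsFBSModel P T H s₀ μ ν S → HasDyadicQV P T S (fun _ _ => 0)) ∧
    (IsBSModel P T s₀ μ σ S →
      HasDyadicQV P T S (fun t ω => ∫ u in (0 : ℝ)..t, σ ^ 2 * S u ω ^ 2)) ∧
    (1 / 2 < H → IsMFBSModel P T H s₀ μ σ ν S →
      HasDyadicQV P T S (fun t ω => ∫ u in (0 : ℝ)..t, σ ^ 2 * S u ω ^ 2)) := by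
  have hlin : ∀ a : ℝ, ContinuousOn (fun s : ℝ => a * s) (Set.Icc 0 T) := fun a =>
    (continuous_const_mul a).continuousOn
  have hscale : ∀ {x : ℝ → ℝ} {t a : ℝ} (c : ℝ), Tendsto (dyadicQVSum T x t) atTop (𝓝 a) →
      Tendsto (dyadicQVSum T (fun s => c * x s) t) atTop (𝓝 (c ^ 2 * a)) := fun c h =>
    (h.const_mul (c ^ 2)).congr fun n => (dyadicQVSum_const_mul T c _ _ n).symm
  have hscale_top : ∀ {x : ℝ → ℝ} {t c : ℝ}, 0 < c → Tendsto (dyadicQVSum T x t) atTop atTop →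
      Tendsto (dyadicQVSum T (fun s => c * x s) t) atTop atTop := fun hc h =>
    (h.const_mul_atTop (pow_pos hc 2)).congr fun n => (dyadicQVSum_const_mul T _ _ _ n).symm
  refine ⟨?_, ?_, ?_, ?_, ?_⟩
  · rintro hH ⟨-, hs₀, hν, B, hB, hS⟩
    filter_upwards [hS, hB.continuous_paths, hB.ae_tendsto_dyadicQVSum_atTop hH hT]
      with ω hSω hBc hBV t ht
    exact tendsto_dyadicQVSum_exp_atTop hT hs₀ ((hlin μ).add (hBc.const_mul ν)) hSω ht.1.le
      (tendsto_dyadicQVSum_add_atTop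
        (tendsto_dyadicQVSum_linear hT μ (Set.Ioc_subset_Icc_self ht)) (hscale_top hν (hBV t ht)))
  · rintro hH ⟨-, hs₀, hσ, hν, W, B, hW, hB, -, hS⟩
    filter_upwards [hS, IsFBM.continuous_paths hW, hB.continuous_paths,
      hW.ae_tendsto_dyadicQVSum hT, hB.ae_tendsto_dyadicQVSum_atTop hH hT]
      with ω hSω hWc hBc hWV hBV t ht
    have ht' := Set.Ioc_subset_Icc_self ht
    -- The drift and `σ W` together have finite quadratic variation, so they cannot offset the
    -- divergence coming from `ν B`.
    refine tendsto_dyadicQVSum_exp_atTop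
      (x := fun s => (σ * W s ω + (μ - 1 / 2 * σ ^ 2) * s) + ν * B s ω) hT hs₀
      (((hWc.const_mul σ).add (hlin _)).add (hBc.const_mul ν)) (fun s hs => ?_) ht.1.le
      (tendsto_dyadicQVSum_add_atTop (tendsto_dyadicQVSum_add (hscale σ (hWV t ht'))
        (tendsto_dyadicQVSum_linear hT _ ht')) (hscale_top hν (hBV t ht)))
    rw [hSω s hs]
    congr 2
    ring
  · rintro hH ⟨-, hs₀, hν, B, hB, hS⟩
    filter_upwards [hS, hB.continuous_paths, hB.ae_tendsto_dyadicQVSum_zero hH hT]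
      with ω hSω hBc hBV t ht
    have h := tendsto_dyadicQVSum_exp hT le_rfl ((hlin μ).add (hBc.const_mul ν)) hSω
      (fun s hs => ?_) ht
    · simpa using h
    · rw [zero_mul]
      exact tendsto_dyadicQVSum_add (tendsto_dyadicQVSum_linear hT μ hs)
        (by simpa using hscale ν (hBV s hs))
  · rintro ⟨hs₀, hσ, W, hW, hS⟩
    filter_upwards [hS, IsFBM.continuous_paths hW, hW.ae_tendsto_dyadicQVSum hT]
      with ω hSω hWc hWV t ht
    refine tendsto_dyadicQVSum_exp (x := fun s => σ * W s ω + (μ - 1 / 2 * σ ^ 2) * s)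
      (s₀ := s₀) hT (sq_nonneg σ) ((hWc.const_mul σ).add (hlin _)) (fun s hs => ?_)
      (fun s hs => tendsto_dyadicQVSum_add (hscale σ (hWV s hs))
        (tendsto_dyadicQVSum_linear hT _ hs)) ht
    rw [hSω s hs]
    congr 2
    ring
  · rintro hH ⟨-, hs₀, hσ, hν, W, B, hW, hB, -, hS⟩
    filter_upwards [hS, IsFBM.continuous_paths hW, hB.continuous_paths,
      hW.ae_tendsto_dyadicQVSum hT, hB.ae_tendsto_dyadicQVSum_zero hH hT]
      with ω hSω hWc hBc hWV hBV t ht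
    -- Both the drift and `ν B` have zero quadratic variation, so the exponent inherits `σ ^ 2 * t`
    -- from `σ W`.
    refine tendsto_dyadicQVSum_exp
      (x := fun s => (σ * W s ω + (μ - 1 / 2 * σ ^ 2) * s) + ν * B s ω)
      (s₀ := s₀) hT (sq_nonneg σ) (((hWc.const_mul σ).add (hlin _)).add (hBc.const_mul ν))
      (fun s hs => ?_)
      (fun s hs => tendsto_dyadicQVSum_add (tendsto_dyadicQVSum_add (hscale σ (hWV s hs))
        (tendsto_dyadicQVSum_linear hT _ hs)) (by simpa using hscale ν (hBV s hs))) ht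
    rw [hSω s hs]
    congr 2
    ring
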